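/- For complex $k,m$ and $z\in\mathbb C\setminus(-\infty,0]$ let $W_{k,m}(z)$ be the (principal branch of the) Whittaker function, $$W_{k,m}(z)=e^{-z/2}z^{\frac12+m}\,U\!\left(\tfrac12+m-k,\,1+2m,\,z\right),$$ where $U$ is Tricomi's confluent hypergeometric function, that is, $$U(a,b,z)=\frac{z^{-a}}{\Gamma(a)}\int_0^\infty e^{-s}s^{a-1}\left(1+\frac sz\right)^{b-a-1}ds\qquad(\operatorname{Re}a>0),$$ extended to all $a\in\mathbb C$ by analytic continuation in $a$ (with $b-a-1$ held fixed); all powers have their principal values. Let $k,m$ be real numbers with $k<\frac12$ and $k-\frac12\le m\le\frac12-k$, and let $x\in\mathbb C$, $x\ne0$, $|\arg x|<\pi$. Then the function $$f(t)=t^{-1}e^{t\operatorname{Re}x}\,|W_{k,m}(tx)|^2$$ is strictly completely monotone on $(0,\infty)$; that is, $f$ is infinitely differentiable on $(0,\infty)$ and $(-1)^n f^{(n)}(t)>0$ for all $t>0$ and $n=0,1,2,\dots$ -/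

import Mathlib

open Set MeasureTheory
open scoped ContDiff

/-- Tricomi's confluent hypergeometric function `U(a, b, z)` (principal branch), for complex
`a`, `b` and `z` in the plane cut along `(-∞, 0]`. For `0 < re a` this is the classical formula
`U(a, b, z) = z^(-a) / Γ(a) * ∫_0^∞ e^(-s) s^(a-1) (1 + s/z)^(b-a-1) ds` (here `n = 0`).
For `re a ≤ 0` that integral diverges at `0`, and it is replaced by its analytic continuation in
the parameter `a`, which `n` integrations by parts provide; `n` is the least natural number with
`0 < re a + n`. -/
noncomputable def tricomiU (a b z : ℂ) : ℂ :=
  let n : ℕ := ⌊1 - a.re⌋₊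
  z ^ (-a) * ((-1) ^ n / Complex.Gamma (a + n)) *
    ∫ s in Ioi (0 : ℝ), (s : ℂ) ^ (a + n - 1) *
      iteratedDeriv n (fun r : ℝ => Complex.exp (-(r : ℂ)) * (1 + (r : ℂ) / z) ^ (b - a - 1)) s

/-- The formula for `0 < re a`. -/
theorem tricomiU_of_re_pos (a b z : ℂ) (ha : 0 < a.re) :
    tricomiU a b z = z ^ (-a) / Complex.Gamma a *
      ∫ s in Ioi (0 : ℝ), (s : ℂ) ^ (a - 1) *
        (Complex.exp (-(s : ℂ)) * (1 + (s : ℂ) / z) ^ (b - a - 1)) := by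
  have hn : ⌊1 - a.re⌋₊ = 0 := Nat.floor_eq_zero.mpr (by linarith)
  simp [tricomiU, hn, div_eq_mul_inv]

/-- The Whittaker function `W_{k,m}(z)` (principal branch), for complex `k`, `m` and `z` in the
plane cut along `(-∞, 0]`: `W_{k,m}(z) = e^(-z/2) z^(1/2+m) U(1/2+m-k, 1+2m, z)`. -/
noncomputable def whittakerW (k m z : ℂ) : ℂ :=
  Complex.exp (-z / 2) * z ^ (1 / 2 + m) * tricomiU (1 / 2 + m - k) (1 + 2 * m) z

/-- `f` is strictly completely monotone on `(0, ∞)`: it is smooth there and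
`(-1)^n f^(n)(t) > 0` for all `t > 0` and `n = 0, 1, 2, …`. -/
def StrictlyCompletelyMonotone (f : ℝ → ℝ) : Prop :=
  ContDiffOn ℝ ∞ f (Ioi 0) ∧ ∀ (n : ℕ) (t : ℝ), 0 < t → 0 < (-1) ^ n * iteratedDeriv n f t

/-! Put a = 1/2 + m - k and c = 1/2 - m - k, so that a, c ≥ 0 and a + c = 1 - 2k > 0. Assume first
a, c > 0, and let I(a,c,z) be the integral of s^(a-1) e^(-s) (1 + s/z)^(-c). Then |W(z)|² = e^(-Re
z) |z|^(2k) |I(a,c,z)|² / Γ(a)², so it suffices to write |I(a,c,tx)|² as t^(a+c) times the Laplace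
transform in t of a positive density: the powers of t then cancel
(`strictlyCompletelyMonotone_of_laplace`).

The square is I(a,c,z) I(a,c,z̄). Kummer's transformation (`Gamma_mul_tricomiIntegral`) turns the
second factor into a multiple of I(c,a,z̄). For z = tx both factors are Laplace transforms up to
powers of t, so the product is the transform of a convolution. With q = 1 + r/x, its value at r is a
power of r times an Euler integral over (0,1) involving (1-s+sq)^(-c) (s+(1-s)q̄)^(-a). A Möbius
substitution shows that such an integral depends only on the product q q̄ = |q|², which makes it
visibly positive (`integral_segment_cpow_conj`). Swapping the exponents by Kummer is what makes the
substitution close up.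

If a = 0 or c = 0, then f(t) is a positive multiple of t^(2k-1), the transform of a power density.
-/

/-! ### Holomorphy of parameter integrals and bounds on the slit plane. -/

open Filter Topology Metric in
/-- A locally dominated integral of holomorphic functions is holomorphic. -/
theorem differentiableAt_integral_of_dominated {α : Type*} [MeasurableSpace α] {μ : Measure α}
    {F : ℂ → α → ℂ} {z₀ : ℂ} {ε : ℝ} (hε : 0 < ε) {bound : α → ℝ}
    (hmeas : ∀ z ∈ ball z₀ ε, AEStronglyMeasurable (F z) μ)
    (hb : ∀ᵐ a ∂μ, ∀ z ∈ ball z₀ ε, ‖F z a‖ ≤ bound a) (hint : Integrable bound μ)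
    (hd : ∀ᵐ a ∂μ, DifferentiableOn ℂ (F · a) (ball z₀ ε)) :
    DifferentiableAt ℂ (fun z => ∫ a, F z a ∂μ) z₀ := by
  have hsub : ball z₀ (ε / 2) ⊆ ball z₀ ε := ball_subset_ball (by linarith)
  have hz₀ : z₀ ∈ ball z₀ ε := mem_ball_self hε
  -- The derivative is an a.e. limit of difference quotients along a sequence, hence measurable.
  have hmeas' : AEStronglyMeasurable (fun a => deriv (F · a) z₀) μ := by
    let h : ℕ → ℂ := fun n => ((ε / 2 * (1 / 2) ^ n : ℝ) : ℂ)
    have hpos : ∀ n : ℕ, 0 < ε / 2 * (1 / 2) ^ n := fun n => by positivity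
    have hh : Tendsto h atTop (𝓝 0) := by
      have := (tendsto_pow_atTop_nhds_zero_of_lt_one (r := (1 / 2 : ℝ)) (by norm_num)
        (by norm_num)).const_mul (ε / 2)
      rw [mul_zero] at this
      exact_mod_cast (Complex.continuous_ofReal.tendsto 0).comp this
    have hmem : ∀ n, z₀ + h n ∈ ball z₀ ε := by
      intro n
      have h1 : (1 / 2 : ℝ) ^ n ≤ 1 := pow_le_one₀ (by norm_num) (by norm_num)
      have := hpos n
      rw [mem_ball, dist_eq_norm, add_sub_cancel_left, Complex.norm_real, Real.norm_eq_abs,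
        abs_of_pos this]
      nlinarith
    refine aestronglyMeasurable_of_tendsto_ae (u := atTop)
      (f := fun n a => (h n)⁻¹ • (F (z₀ + h n) a - F z₀ a)) ?_ ?_
    · exact fun n => ((hmeas _ (hmem n)).sub (hmeas _ hz₀)).const_smul (h n)⁻¹
    · filter_upwards [hd] with a ha
      have hda := (ha.differentiableAt (ball_mem_nhds _ hε)).hasDerivAt
      rw [hasDerivAt_iff_tendsto_slope_zero] at hda
      refine hda.comp (tendsto_nhdsWithin_iff.2 ⟨hh, Eventually.of_forall fun n => ?_⟩)
      simpa [h] using hε.ne'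
  refine (hasDerivAt_integral_of_dominated_loc_of_deriv_le (s := ball z₀ (ε / 2))
    (F' := fun z a => deriv (F · a) z) (bound := fun a => bound a / (ε / 4))
    (ball_mem_nhds _ (by linarith)) ?_ ?_ hmeas' ?_ (hint.div_const _) ?_).2.differentiableAt
  · filter_upwards [ball_mem_nhds z₀ hε] with z hz using hmeas z hz
  · exact hint.mono' (hmeas _ hz₀) (hb.mono fun a ha => ha _ hz₀)
  -- Cauchy's estimate on circles of radius ε/4 about points of the half-size ball bounds the
  -- derivative by `bound a / (ε / 4)`.
  · filter_upwards [hb, hd] with a ha hda z hz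
    have hcl : closedBall z (ε / 4) ⊆ ball z₀ ε := by
      intro w hw
      rw [mem_closedBall] at hw
      rw [mem_ball] at hz ⊢
      linarith [dist_triangle w z z₀]
    refine Complex.norm_deriv_le_of_forall_mem_sphere_norm_le (by linarith) ?_ ?_
    · exact (hda.mono hcl).diffContOnCl_ball Subset.rfl
    · exact fun w hw => ha w (hcl (sphere_subset_closedBall hw))
  · filter_upwards [hd] with a ha z hz
    exact (ha.differentiableAt (isOpen_ball.mem_nhds (hsub hz))).hasDerivAt

/-- The segment from `1` to a point of the slit plane stays away from `0`, locally uniformly. -/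
theorem exists_le_norm_segment_of_mem_slitPlane {w₀ : ℂ} (hw₀ : w₀ ∈ Complex.slitPlane) :
    ∃ ε > 0, ∃ δ > 0, Metric.ball w₀ ε ⊆ Complex.slitPlane ∧
      ∀ w ∈ Metric.ball w₀ ε, ∀ σ ∈ Icc (0 : ℝ) 1, δ ≤ ‖(1 - σ : ℂ) + σ * w‖ := by
  obtain ⟨ε, hε, hsub⟩ := Metric.nhds_basis_closedBall.mem_iff.1
    (Complex.isOpen_slitPlane.mem_nhds hw₀)
  have hK : IsCompact (Metric.closedBall w₀ ε ×ˢ Icc (0 : ℝ) 1) :=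
    (isCompact_closedBall _ _).prod isCompact_Icc
  have hne : (Metric.closedBall w₀ ε ×ˢ Icc (0 : ℝ) 1).Nonempty :=
    ⟨(w₀, 0), Metric.mem_closedBall_self hε.le, by simp⟩
  obtain ⟨p, hp, hmin⟩ := hK.exists_isMinOn hne
    (f := fun p : ℂ × ℝ => ‖(1 - p.2 : ℂ) + p.2 * p.1‖) (by fun_prop)
  refine ⟨ε, hε, _, ?_, Metric.ball_subset_closedBall.trans hsub, fun w hw σ hσ =>
    hmin (show (w, σ) ∈ _ from ⟨Metric.ball_subset_closedBall hw, hσ⟩)⟩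
  -- δ is the minimum over a compact set; it is positive because the slit plane is star-shaped about
  -- 1.
  have := Complex.starConvex_one_slitPlane (hsub hp.1) (sub_nonneg.2 hp.2.2) hp.2.1 (by ring)
  simpa using Complex.slitPlane_ne_zero this

theorem segment_mem_slitPlane {w : ℂ} (hw : w ∈ Complex.slitPlane) {σ : ℝ} (hσ : σ ∈ Icc (0 : ℝ) 1) :
    (1 - σ : ℂ) + σ * w ∈ Complex.slitPlane := by
  simpa using Complex.starConvex_one_slitPlane hw (sub_nonneg.2 hσ.2) hσ.1 (by ring)

theorem norm_cpow_neg_le {z : ℂ} {δ c : ℝ} (hδ : 0 < δ) (hz : δ ≤ ‖z‖) (hc : 0 ≤ c) :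
    ‖z ^ (-c : ℂ)‖ ≤ δ ^ (-c) := by
  rw [← Complex.ofReal_neg, Complex.norm_cpow_real]
  exact Real.rpow_le_rpow_of_nonpos hδ hz (by linarith)

/-! ### Laplace transforms and complete monotonicity. -/

open ProbabilityTheory in
/-- A Laplace transform of a positive density is strictly completely monotone. -/
theorem strictlyCompletelyMonotone_of_laplace {f h : ℝ → ℝ}
    (hpos : ∀ r, 0 < r → 0 < h r)
    (hint : ∀ t, 0 < t → IntegrableOn (fun r => Real.exp (-(t * r)) * h r) (Ioi 0))
    (hf : ∀ t, 0 < t → f t = ∫ r in Ioi 0, Real.exp (-(t * r)) * h r) :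
    StrictlyCompletelyMonotone f := by
  have hmeas : AEMeasurable h (volume.restrict (Ioi 0)) := by
    have h1 := (hint 1 one_pos).aemeasurable
    have h2 : Measurable fun r : ℝ => Real.exp r := Real.measurable_exp
    refine (h2.aemeasurable.mul h1).congr (Filter.Eventually.of_forall fun r => ?_)
    simp [← mul_assoc, ← Real.exp_add]
  let d : ℝ → ENNReal := fun r => ENNReal.ofReal (h r)
  have hd : AEMeasurable d (volume.restrict (Ioi 0)) := hmeas.ennreal_ofReal
  have hdlt : ∀ᵐ r ∂(volume.restrict (Ioi (0 : ℝ))), d r < ⊤ :=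
    Filter.Eventually.of_forall fun r => ENNReal.ofReal_lt_top
  let μ : Measure ℝ := (volume.restrict (Ioi 0)).withDensity d
  have hsmul : ∀ g : ℝ → ℝ, (fun r => (d r).toReal • g r) =ᵐ[volume.restrict (Ioi 0)]
      fun r => g r * h r := fun g => by
    filter_upwards [ae_restrict_mem measurableSet_Ioi] with r hr
    simp [d, ENNReal.toReal_ofReal (hpos r hr).le, mul_comm]
  have hI : ∀ g : ℝ → ℝ, Integrable g μ ↔ IntegrableOn (fun r => g r * h r) (Ioi 0) := fun g => by
    rw [integrable_withDensity_iff_integrable_smul₀' hd hdlt]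
    exact integrable_congr (hsmul g)
  have hE : ∀ g : ℝ → ℝ, ∫ r, g r ∂μ = ∫ r in Ioi 0, g r * h r := fun g => by
    rw [integral_withDensity_eq_integral_toReal_smul₀ hd hdlt]
    exact integral_congr_ae (hsmul g)
  -- The transform is the moment generating function of -r under the measure with density h, so
  -- smoothness and differentiation under the integral come from the theory of `mgf`.
  let X : ℝ → ℝ := fun r => -r
  have hX : ∀ t r : ℝ, Real.exp (t * X r) = Real.exp (-(t * r)) := fun t r => by simp [X]
  have hset : Ioi (0 : ℝ) ⊆ interior (integrableExpSet X μ) := by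
    refine interior_maximal (fun t ht => ?_) isOpen_Ioi
    change Integrable _ μ
    rw [hI]
    simpa only [hX] using hint t ht
  have hfm : ∀ t ∈ Ioi (0 : ℝ), f t = mgf X μ t := fun t ht => by
    rw [hf t ht, mgf, hE]
    simp only [hX]
  constructor
  · exact ((analyticOnNhd_mgf.mono hset).contDiffOn (uniqueDiffOn_Ioi 0)).congr hfm
  · intro n t ht
    have hev : f =ᶠ[nhds t] mgf X μ := Filter.eventuallyEq_of_mem (isOpen_Ioi.mem_nhds ht) hfm
    rw [hev.iteratedDeriv_eq, iteratedDeriv_mgf (hset ht), ← integral_const_mul, hE]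
    have hi := integrable_pow_mul_exp_of_mem_interior_integrableExpSet (hset ht) n
    rw [hI] at hi
    have heq : ∀ r, (-1) ^ n * (X r ^ n * Real.exp (t * X r)) * h r
        = r ^ n * Real.exp (-(t * r)) * h r := fun r => by
      rw [hX, ← mul_assoc, ← mul_pow]
      simp [X]
    simp only [heq]
    have hi' : IntegrableOn (fun r => r ^ n * Real.exp (-(t * r)) * h r) (Ioi 0) := by
      refine (hi.const_mul ((-1) ^ n)).congr (Filter.Eventually.of_forall fun r => ?_)
      simp only [← heq]
      ring
    refine (setIntegral_pos_iff_support_of_nonneg_ae ?_ hi').2 ?_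
    · filter_upwards [ae_restrict_mem measurableSet_Ioi] with r hr
      have := hpos r hr
      have hr : 0 < r := hr
      simp only [Pi.zero_apply]
      positivity
    · have : Ioi (0 : ℝ) ⊆ Function.support fun r => r ^ n * Real.exp (-(t * r)) * h r := by
        intro r hr
        have := hpos r hr
        have hr : 0 < r := hr
        rw [Function.mem_support]
        positivity
      rw [inter_eq_self_of_subset_right this]
      simp

/-! ### The Euler integral and its Möbius invariance. -/

/-- The substitution s ↦ ps/(1-s+ps) maps (0,1) onto itself and sends each factor to a multiple of a
power of D = 1-s+ps. The Jacobian p/D² cancels all remaining powers of p and D. -/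
theorem integral_Ioo_rpow_mobius (a c : ℝ) {p q : ℝ} (hp : 0 < p) (hq : 0 < q) :
    ∫ s in Ioo (0 : ℝ) 1, s ^ (a - 1) * (1 - s) ^ (c - 1) * (1 - s + s * q) ^ (-c) *
        (s + (1 - s) * p) ^ (-a) =
      ∫ s in Ioo (0 : ℝ) 1, s ^ (a - 1) * (1 - s) ^ (c - 1) * (1 - s + s * (q * p)) ^ (-c) := by
  let φ : ℝ → ℝ := fun s => p * s / (1 - s + p * s)
  have hD : ∀ s ∈ Ioo (0 : ℝ) 1, 0 < 1 - s + p * s := fun s hs => by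
    have := mul_pos hp hs.1
    linarith [hs.2]
  have himg : φ '' Ioo 0 1 = Ioo 0 1 := by
    ext u
    constructor
    · rintro ⟨s, hs, rfl⟩
      have := hD s hs
      refine ⟨div_pos (mul_pos hp hs.1) this, ?_⟩
      rw [div_lt_one this]
      linarith [hs.2]
    · intro hu
      have h1 : 0 < p * (1 - u) := mul_pos hp (by linarith [hu.2])
      have h2 : 0 < u + p * (1 - u) := by linarith [hu.1]
      refine ⟨u / (u + p * (1 - u)), ⟨div_pos hu.1 h2, ?_⟩, ?_⟩
      · rw [div_lt_one h2]
        linarith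
      · simp only [φ]
        have : 1 - u / (u + p * (1 - u)) + p * (u / (u + p * (1 - u))) = p / (u + p * (1 - u)) := by
          field_simp
          ring
        rw [this]
        field_simp
  have hder : ∀ s ∈ Ioo (0 : ℝ) 1, HasDerivWithinAt φ (p / (1 - s + p * s) ^ 2) (Ioo 0 1) s := by
    intro s hs
    have h1 : HasDerivAt (fun s : ℝ => p * s) p s := by simpa using (hasDerivAt_id s).const_mul p
    have h2 : HasDerivAt (fun s : ℝ => 1 - s + p * s) (-1 + p) s :=
      ((hasDerivAt_id s).const_sub 1).add h1
    convert! (h1.div h2 (hD s hs).ne').hasDerivWithinAt using 1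
    congr 1
    ring
  have hinj : InjOn φ (Ioo 0 1) := by
    intro s hs u hu h
    have h1 := hD s hs
    have h2 := hD u hu
    simp only [φ] at h
    rw [div_eq_div_iff h1.ne' h2.ne'] at h
    have : p * (s - u) = 0 := by linarith
    rcases mul_eq_zero.1 this with h | h
    · exact absurd h hp.ne'
    · linarith
  have key := integral_image_eq_integral_abs_deriv_smul measurableSet_Ioo hder hinj
    fun s : ℝ => s ^ (a - 1) * (1 - s) ^ (c - 1) * (1 - s + s * q) ^ (-c) *
        (s + (1 - s) * p) ^ (-a)
  rw [himg] at key
  rw [key]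
  refine setIntegral_congr_fun measurableSet_Ioo fun s hs => ?_
  have h1 := hD s hs
  have hs0 : 0 < s := hs.1
  have hs1 : 0 < 1 - s := by linarith [hs.2]
  have hE : 0 < 1 - s + s * (q * p) := by positivity
  set D := 1 - s + p * s with hDdef
  have e1 : 1 - φ s = (1 - s) / D := by
    simp only [φ, ← hDdef]; rw [eq_div_iff h1.ne', sub_mul, div_mul_cancel₀ _ h1.ne']; ring
  have e2 : 1 - φ s + φ s * q = (1 - s + s * (q * p)) / D := by
    rw [e1]; simp only [φ, ← hDdef]; field_simp
  have e3 : φ s + (1 - φ s) * p = p / D := by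
    rw [e1]; simp only [φ, ← hDdef]; field_simp; ring
  have e4 : φ s = p * s / D := rfl
  simp only [smul_eq_mul]
  rw [e2, e3, e1, e4, abs_of_pos (by positivity), Real.div_rpow (by positivity) h1.le,
    Real.div_rpow hs1.le h1.le, Real.div_rpow hE.le h1.le, Real.div_rpow hp.le h1.le,
    Real.mul_rpow hp.le hs0.le]
  have hpp : p ^ (a - 1) * p ^ (-a) * p = 1 := by
    rw [← Real.rpow_add hp, ← Real.rpow_add_one hp.ne', show a - 1 + -a + 1 = 0 by ring,
      Real.rpow_zero]
  have hDD : D ^ (a - 1) * D ^ (c - 1) * D ^ (-c) * D ^ (-a) * D ^ 2 = 1 := by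
    rw [← Real.rpow_add h1, ← Real.rpow_add h1, ← Real.rpow_add h1, ← Real.rpow_natCast,
      ← Real.rpow_add h1]
    rw [show a - 1 + (c - 1) + -c + -a + ((2 : ℕ) : ℝ) = 0 by push_cast; ring, Real.rpow_zero]
  have hA := Real.rpow_pos_of_pos h1 (a - 1)
  have hB := Real.rpow_pos_of_pos h1 (c - 1)
  have hC := Real.rpow_pos_of_pos h1 (-c)
  have hF := Real.rpow_pos_of_pos h1 (-a)
  generalize D ^ (a - 1) = A at *
  generalize D ^ (c - 1) = B at *
  generalize D ^ (-c) = C at *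
  generalize D ^ (-a) = F at *
  generalize (1 - s + s * (q * p)) ^ (-c) = G at *
  generalize (1 - s) ^ (c - 1) = H at *
  generalize s ^ (a - 1) = K at *
  generalize p ^ (a - 1) = M at *
  generalize p ^ (-a) = N at *
  have : p / D ^ 2 * (M * K / A * (H / B) * (G / C) * (N / F))
      = K * H * G * (M * N * p) / (A * B * C * F * D ^ 2) := by
    field_simp
  rw [this, hpp, hDD]
  ring

theorem integrableOn_beta {a c : ℝ} (ha : 0 < a) (hc : 0 < c) :
    IntegrableOn (fun s : ℝ => s ^ (a - 1) * (1 - s) ^ (c - 1)) (Ioo 0 1) := by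
  have h := Complex.betaIntegral_convergent (u := a) (v := c) (by simpa) (by simpa)
  rw [intervalIntegrable_iff_integrableOn_Ioo_of_le zero_le_one] at h
  refine (integrableOn_congr_fun (fun s hs => ?_) measurableSet_Ioo).1 h.norm
  have : (1 - s : ℂ) = ((1 - s : ℝ) : ℂ) := by push_cast; rfl
  rw [norm_mul, this, Complex.norm_cpow_eq_rpow_re_of_pos hs.1,
    Complex.norm_cpow_eq_rpow_re_of_pos (by linarith [hs.2])]
  simp

theorem exp_mem_slitPlane_of_abs_im_lt {z : ℂ} (hz : |z.im| < Real.pi) :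
    Complex.exp z ∈ Complex.slitPlane := by
  rw [abs_lt] at hz
  rw [Complex.mem_slitPlane_iff_arg, Complex.arg_exp,
    (toIocMod_eq_self Real.two_pi_pos).2 ⟨hz.1, by linarith⟩]
  exact ⟨hz.2.ne, Complex.exp_ne_zero _⟩

theorem abs_arg_lt_pi_of_mem_slitPlane {z : ℂ} (hz : z ∈ Complex.slitPlane) :
    |z.arg| < Real.pi :=
  abs_lt.2 ⟨Complex.neg_pi_lt_arg z,
    lt_of_le_of_ne (Complex.arg_le_pi z) (Complex.slitPlane_arg_ne_pi hz)⟩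

/-- Input for the identity theorem: the points x + 1/(n+1) accumulate at x. -/
theorem frequently_nhdsNE_ofReal {p : ℂ → Prop} {x : ℝ} (h : ∀ y : ℝ, x < y → p y) :
    ∃ᶠ z in nhdsWithin (x : ℂ) {(x : ℂ)}ᶜ, p z := by
  have ht : Filter.Tendsto (fun n : ℕ => ((x + 1 / ((n : ℝ) + 1) : ℝ) : ℂ)) Filter.atTop
      (nhdsWithin (x : ℂ) {(x : ℂ)}ᶜ) := by
    refine tendsto_nhdsWithin_iff.2 ⟨?_, Filter.Eventually.of_forall fun n => ?_⟩
    · refine (Complex.continuous_ofReal.tendsto x).comp ?_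
      simpa using (tendsto_one_div_add_atTop_nhds_zero_nat (𝕜 := ℝ)).const_add x
    · have : (0 : ℝ) < 1 / ((n : ℝ) + 1) := by positivity
      rw [mem_compl_singleton_iff, Ne, Complex.ofReal_inj]
      linarith
  refine ht.frequently (Filter.Frequently.of_forall fun n => h _ ?_)
  have : (0 : ℝ) < 1 / ((n : ℝ) + 1) := by positivity
  linarith

theorem convex_strip : Convex ℝ {z : ℂ | |z.im| < Real.pi} := by
  have : {z : ℂ | |z.im| < Real.pi} = Complex.imLm ⁻¹' Metric.ball 0 Real.pi := by
    ext z; simp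
  rw [this]
  exact (convex_ball _ _).linear_preimage _

theorem isOpen_strip : IsOpen {z : ℂ | |z.im| < Real.pi} :=
  isOpen_lt (by fun_prop) continuous_const

/-- With q = e^z and p = ρe^(-z), the product pq stays equal to ρ while both points stay in the slit
plane throughout the strip. The form 1 - (1-s) exhibits the second base as a point of the segment
with parameter 1-s. -/
theorem differentiableAt_integral_segment_cpow {a c ρ : ℝ} (ha : 0 < a) (hc : 0 < c) (hρ : 0 < ρ)
    {ζ : ℂ} (hζ : |ζ.im| < Real.pi) :
    DifferentiableAt ℂ (fun z : ℂ => ∫ s in Ioo (0 : ℝ) 1,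
      ((s ^ (a - 1) * (1 - s) ^ (c - 1) : ℝ) : ℂ) *
      (((1 - s : ℂ) + s * Complex.exp z) ^ (-c : ℂ) *
      ((1 - (1 - s : ℝ) : ℂ) + (1 - s : ℝ) * (ρ * Complex.exp (-z))) ^ (-a : ℂ))) ζ := by
  have hm1 : Complex.exp ζ ∈ Complex.slitPlane := exp_mem_slitPlane_of_abs_im_lt hζ
  have hm2 : (ρ : ℂ) * Complex.exp (-ζ) ∈ Complex.slitPlane := by
    have : (ρ : ℂ) * Complex.exp (-ζ) = Complex.exp (Real.log ρ - ζ) := by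
      rw [Complex.exp_sub, ← Complex.ofReal_exp, Real.exp_log hρ, Complex.exp_neg, div_eq_mul_inv]
    rw [this]
    exact exp_mem_slitPlane_of_abs_im_lt (by simpa using hζ)
  obtain ⟨ε₁, hε₁, δ₁, hδ₁, hs₁, hb₁⟩ := exists_le_norm_segment_of_mem_slitPlane hm1
  obtain ⟨ε₂, hε₂, δ₂, hδ₂, hs₂, hb₂⟩ := exists_le_norm_segment_of_mem_slitPlane hm2
  have hc1 : ContinuousAt (fun z : ℂ => Complex.exp z) ζ := by fun_prop
  have hc2 : ContinuousAt (fun z : ℂ => (ρ : ℂ) * Complex.exp (-z)) ζ := by fun_prop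
  obtain ⟨ε, hε, hball⟩ := Metric.mem_nhds_iff.1 (Filter.inter_mem
    (hc1.preimage_mem_nhds (Metric.ball_mem_nhds _ hε₁))
    (hc2.preimage_mem_nhds (Metric.ball_mem_nhds _ hε₂)))
  refine differentiableAt_integral_of_dominated hε
    (bound := fun s => s ^ (a - 1) * (1 - s) ^ (c - 1) * (δ₁ ^ (-c) * δ₂ ^ (-a)))
    (fun z _ => Measurable.aestronglyMeasurable (by fun_prop)) ?_
    ((integrableOn_beta ha hc).mul_const _) ?_
  · filter_upwards [ae_restrict_mem measurableSet_Ioo] with s hs z hz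
    have hs0 := hs.1
    have hs1 : 0 < 1 - s := by linarith [hs.2]
    rw [norm_mul, norm_mul, Complex.norm_real, Real.norm_of_nonneg (by positivity)]
    gcongr
    · exact norm_cpow_neg_le hδ₁ (hb₁ _ (hball hz).1 s ⟨hs.1.le, hs.2.le⟩) hc.le
    · exact norm_cpow_neg_le hδ₂ (hb₂ _ (hball hz).2 (1 - s) ⟨hs1.le, by linarith⟩) ha.le
  · filter_upwards [ae_restrict_mem measurableSet_Ioo] with s hs z hz
    have h1 := segment_mem_slitPlane (hs₁ (hball hz).1) (σ := s) ⟨hs.1.le, hs.2.le⟩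
    have h2 := segment_mem_slitPlane (hs₂ (hball hz).2) (σ := 1 - s)
      ⟨by linarith [hs.2], by linarith [hs.1]⟩
    refine DifferentiableAt.differentiableWithinAt (DifferentiableAt.const_mul ?_ _)
    exact DifferentiableAt.mul (DifferentiableAt.cpow_const (by fun_prop) h1)
      (DifferentiableAt.cpow_const (by fun_prop) h2)

/-- The Möbius substitution is only available for real positive p, q. In the coordinates q = e^z, p
= |q|²e^(-z) it says that a holomorphic function on the strip |Im z| < π is constant on the real
line; hence it is constant on the strip. -/
theorem integral_segment_cpow_conj {a c : ℝ} (ha : 0 < a) (hc : 0 < c) {q : ℂ}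
    (hq : q ∈ Complex.slitPlane) :
    ∫ s in Ioo (0 : ℝ) 1, ((s ^ (a - 1) * (1 - s) ^ (c - 1) : ℝ) : ℂ) *
      (((1 - s : ℂ) + s * q) ^ (-c : ℂ) * ((s : ℂ) + (1 - s) * starRingEnd ℂ q) ^ (-a : ℂ)) =
      ((∫ s in Ioo (0 : ℝ) 1, s ^ (a - 1) * (1 - s) ^ (c - 1) *
        (1 - s + s * Complex.normSq q) ^ (-c) : ℝ) : ℂ) := by
  have hq0 := Complex.slitPlane_ne_zero hq
  set ρ := Complex.normSq q with hρdef
  have hρ : 0 < ρ := Complex.normSq_pos.2 hq0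
  set J : ℂ → ℂ := fun z : ℂ => ∫ s in Ioo (0 : ℝ) 1,
      ((s ^ (a - 1) * (1 - s) ^ (c - 1) : ℝ) : ℂ) *
      (((1 - s : ℂ) + s * Complex.exp z) ^ (-c : ℂ) *
      ((1 - (1 - s : ℝ) : ℂ) + (1 - s : ℝ) * (ρ * Complex.exp (-z))) ^ (-a : ℂ)) with hJ
  have han : AnalyticOnNhd ℂ J {z : ℂ | |z.im| < Real.pi} :=
    DifferentiableOn.analyticOnNhd (fun ζ hζ =>
      (differentiableAt_integral_segment_cpow ha hc hρ hζ).differentiableWithinAt) isOpen_strip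
  have hreal : ∀ y : ℝ, J y = ((∫ s in Ioo (0 : ℝ) 1, s ^ (a - 1) * (1 - s) ^ (c - 1) *
        (1 - s + s * ρ) ^ (-c) : ℝ) : ℂ) := by
    intro y
    have h := integral_Ioo_rpow_mobius a c (p := ρ * Real.exp (-y)) (q := Real.exp y)
      (by positivity) (by positivity)
    rw [show Real.exp y * (ρ * Real.exp (-y)) = ρ * (Real.exp y * Real.exp (-y)) by ring,
      ← Real.exp_add, add_neg_cancel, Real.exp_zero, mul_one] at h
    rw [← h, ← integral_complex_ofReal]
    refine setIntegral_congr_fun measurableSet_Ioo fun s hs => ?_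
    have hs0 := hs.1
    have hs1 : 0 < 1 - s := by linarith [hs.2]
    have e1 : (((1 - s + s * Real.exp y) ^ (-c) : ℝ) : ℂ) =
        ((1 - s : ℂ) + s * Complex.exp y) ^ (-c : ℂ) := by
      rw [Complex.ofReal_cpow (by positivity)]
      push_cast
      rfl
    have e2 : (((s + (1 - s) * (ρ * Real.exp (-y))) ^ (-a) : ℝ) : ℂ) =
        ((1 - (1 - s : ℝ) : ℂ) + (1 - s : ℝ) * (ρ * Complex.exp (-y))) ^ (-a : ℂ) := by
      rw [Complex.ofReal_cpow (by positivity)]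
      push_cast
      rw [sub_sub_cancel]
    rw [← e1, ← e2]
    simp only [Complex.ofReal_mul]
    ring
  have hfreq : ∃ᶠ z in nhdsWithin (0 : ℂ) {0}ᶜ, J z = ((∫ s in Ioo (0 : ℝ) 1,
      s ^ (a - 1) * (1 - s) ^ (c - 1) * (1 - s + s * ρ) ^ (-c) : ℝ) : ℂ) := by
    simpa using frequently_nhdsNE_ofReal (p := fun z => J z = _) (x := 0) fun y _ => hreal y
  have hmem : Complex.log q ∈ {z : ℂ | |z.im| < Real.pi} := by
    simpa only [mem_ofPred_eq, Complex.log_im] using abs_arg_lt_pi_of_mem_slitPlane hq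
  have heq := han.eqOn_of_preconnected_of_frequently_eq analyticOnNhd_const
    convex_strip.isPreconnected (by simp [Real.pi_pos]) hfreq hmem
  simp only at heq
  rw [← heq, hJ]
  -- At z = log q the second parameter is |q|²/q = q̄.
  have : (ρ : ℂ) * Complex.exp (-Complex.log q) = starRingEnd ℂ q := by
    rw [Complex.exp_neg, Complex.exp_log hq0, hρdef, Complex.normSq_eq_conj_mul_self,
      mul_inv_cancel_right₀ hq0]
  simp only [this, Complex.exp_log hq0]
  push_cast
  simp only [sub_sub_cancel]

/-! ### The Tricomi integral and Kummer's transformation. -/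

/-- The integral in the classical formula for the Tricomi function, with `b - a - 1 = -c`. -/
noncomputable def tricomiIntegral (a c : ℝ) (z : ℂ) : ℂ :=
  ∫ s in Ioi (0 : ℝ), ((s ^ (a - 1) * Real.exp (-s) : ℝ) : ℂ) * (1 + (s : ℂ) / z) ^ (-c : ℂ)

theorem integrableOn_rpow_mul_exp_neg_mul {a t : ℝ} (ha : 0 < a) (ht : 0 < t) :
    IntegrableOn (fun s : ℝ => s ^ (a - 1) * Real.exp (-(t * s))) (Ioi 0) := by
  have := integrableOn_rpow_mul_exp_neg_mul_rpow (p := 1) (s := a - 1) (b := t) (by linarith)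
    one_pos ht
  simpa using this

/-- Rescaling by 1 + s ≥ 1 carries the unbounded ray to the segment from 1 to w, so lower bounds on
the segment serve all s ≥ 0. -/
theorem one_add_mul_eq_segment {s : ℝ} (hs : 0 ≤ s) (w : ℂ) :
    1 + s * w = (1 + s : ℝ) * ((1 - (s / (1 + s) : ℝ) : ℂ) + (s / (1 + s) : ℝ) * w) := by
  have : (1 + s : ℂ) ≠ 0 := by exact_mod_cast (by positivity : (1 + s : ℝ) ≠ 0)
  push_cast
  field_simp
  ring

theorem div_one_add_mem_Icc {s : ℝ} (hs : 0 ≤ s) : s / (1 + s) ∈ Icc (0 : ℝ) 1 :=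
  ⟨by positivity, div_le_one_of_le₀ (by linarith) (by positivity)⟩

theorem one_add_mul_mem_slitPlane {w : ℂ} (hw : w ∈ Complex.slitPlane) {s : ℝ} (hs : 0 ≤ s) :
    1 + s * w ∈ Complex.slitPlane := by
  rcases hs.eq_or_lt with rfl | hs
  · simp
  rw [Complex.mem_slitPlane_iff] at hw ⊢
  rcases hw with h | h
  · left
    simp
    positivity
  · right
    simp [hs.ne', h]

theorem inv_mem_slitPlane {w : ℂ} (hw : w ∈ Complex.slitPlane) : w⁻¹ ∈ Complex.slitPlane := by
  rw [Complex.mem_slitPlane_iff_arg] at hw ⊢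
  refine ⟨?_, inv_ne_zero hw.2⟩
  rw [Complex.arg_inv, if_neg hw.1]
  exact fun h => (Complex.neg_pi_lt_arg w).ne (by linarith)

theorem one_add_div_mem_slitPlane {z : ℂ} (hz : z ∈ Complex.slitPlane) {s : ℝ} (hs : 0 ≤ s) :
    1 + s / z ∈ Complex.slitPlane := by
  rw [div_eq_mul_inv]
  exact one_add_mul_mem_slitPlane (inv_mem_slitPlane hz) hs

theorem exists_norm_one_add_div_cpow_neg_le {z₀ : ℂ} (hz₀ : z₀ ∈ Complex.slitPlane) {c : ℝ}
    (hc : 0 ≤ c) : ∃ ε > 0, ∃ C : ℝ, Metric.ball z₀ ε ⊆ Complex.slitPlane ∧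
      ∀ z ∈ Metric.ball z₀ ε, ∀ s : ℝ, 0 ≤ s → ‖(1 + (s : ℂ) / z) ^ (-c : ℂ)‖ ≤ C := by
  obtain ⟨ε₁, hε₁, δ, hδ, -, hb⟩ := exists_le_norm_segment_of_mem_slitPlane (inv_mem_slitPlane hz₀)
  have hcont : ContinuousAt (fun z : ℂ => z⁻¹) z₀ :=
    continuousAt_inv₀ (Complex.slitPlane_ne_zero hz₀)
  obtain ⟨ε, hε, hball⟩ := Metric.mem_nhds_iff.1 (Filter.inter_mem
    (hcont.preimage_mem_nhds (Metric.ball_mem_nhds _ hε₁))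
    (Complex.isOpen_slitPlane.mem_nhds hz₀))
  refine ⟨ε, hε, δ ^ (-c), fun z hz => (hball hz).2, fun z hz s hs => norm_cpow_neg_le hδ ?_ hc⟩
  rw [div_eq_mul_inv, one_add_mul_eq_segment hs, norm_mul, Complex.norm_real,
    Real.norm_of_nonneg (by positivity)]
  have := hb z⁻¹ (hball hz).1 _ (div_one_add_mem_Icc hs)
  nlinarith

theorem differentiableOn_tricomiIntegral {a c : ℝ} (ha : 0 < a) (hc : 0 ≤ c) :
    DifferentiableOn ℂ (tricomiIntegral a c) Complex.slitPlane := by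
  intro z₀ hz₀
  obtain ⟨ε, hε, C, hsub, hC⟩ := exists_norm_one_add_div_cpow_neg_le hz₀ hc
  have hint := integrableOn_rpow_mul_exp_neg_mul ha one_pos
  simp only [one_mul] at hint
  refine (differentiableAt_integral_of_dominated hε
    (bound := fun s => s ^ (a - 1) * Real.exp (-s) * C)
    (fun z _ => Measurable.aestronglyMeasurable (by fun_prop)) ?_
    (hint.mul_const _) ?_).differentiableWithinAt
  · filter_upwards [ae_restrict_mem measurableSet_Ioi] with s hs z hz
    have hs : 0 < s := hs
    rw [norm_mul, Complex.norm_real, Real.norm_of_nonneg (by positivity)]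
    gcongr
    exact hC z hz s hs.le
  · filter_upwards [ae_restrict_mem measurableSet_Ioi] with s hs z hz
    have hs : 0 < s := hs
    have hz0 := Complex.slitPlane_ne_zero (hsub hz)
    refine DifferentiableAt.differentiableWithinAt (DifferentiableAt.const_mul ?_ _)
    exact DifferentiableAt.cpow_const (by fun_prop (disch := assumption))
      (one_add_div_mem_slitPlane (hsub hz) hs.le)

/-- Writing Γ(c)(1+s/x)^(-c) as a Gamma integral in u gives a double integral whose kernel
e^(-s-u-su/x) is symmetric in s and u; Fubini exchanges a and c. -/
theorem Gamma_mul_tricomiIntegral_of_pos {a c x : ℝ} (ha : 0 < a) (hc : 0 < c) (hx : 0 < x) :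
    (Real.Gamma c : ℂ) * tricomiIntegral a c x = Real.Gamma a * tricomiIntegral c a x := by
  have hreal : ∀ a c : ℝ, 0 < a → 0 < c → (Real.Gamma c : ℂ) * tricomiIntegral a c x =
      ((∫ s in Ioi (0 : ℝ), ∫ u in Ioi (0 : ℝ), s ^ (a - 1) * u ^ (c - 1) *
        Real.exp (-s - u - s * u / x) : ℝ) : ℂ) := by
    intro a c ha hc
    have h1 : tricomiIntegral a c x = ((∫ s in Ioi (0 : ℝ), s ^ (a - 1) * Real.exp (-s) *
        (1 + s / x) ^ (-c) : ℝ) : ℂ) := by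
      rw [tricomiIntegral, ← integral_complex_ofReal]
      refine setIntegral_congr_fun measurableSet_Ioi fun s hs => ?_
      have hs : 0 < s := hs
      rw [Complex.ofReal_mul _ ((1 + s / x) ^ (-c)), Complex.ofReal_cpow (by positivity)]
      push_cast
      rfl
    rw [h1, ← Complex.ofReal_mul, ← integral_const_mul]
    congr 1
    refine setIntegral_congr_fun measurableSet_Ioi fun s hs => ?_
    have hs : 0 < s := hs
    have h2 := Real.integral_rpow_mul_exp_neg_mul_Ioi hc (r := 1 + s / x) (by positivity)
    have h3 : ∀ u : ℝ, s ^ (a - 1) * u ^ (c - 1) * Real.exp (-s - u - s * u / x) =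
        s ^ (a - 1) * Real.exp (-s) * (u ^ (c - 1) * Real.exp (-((1 + s / x) * u))) := fun u => by
      rw [show -s - u - s * u / x = -s + -((1 + s / x) * u) by ring, Real.exp_add]
      ring
    simp only [h3]
    rw [integral_const_mul, h2, one_div, Real.inv_rpow (by positivity), Real.rpow_neg (by positivity)]
    ring
  rw [hreal a c ha hc, hreal c a hc ha]
  congr 1
  rw [integral_integral_swap]
  · refine setIntegral_congr_fun measurableSet_Ioi fun u _ => ?_
    refine setIntegral_congr_fun measurableSet_Ioi fun s _ => ?_
    rw [show -s - u - s * u / x = -u - s - u * s / x by ring]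
    ring
  · have hA := integrableOn_rpow_mul_exp_neg_mul ha one_pos
    have hB := integrableOn_rpow_mul_exp_neg_mul hc one_pos
    refine (Integrable.mul_prod hA hB).mono' (Measurable.aestronglyMeasurable ?_) ?_
    · simp only [Function.uncurry_def]
      fun_prop
    · rw [Measure.prod_restrict]
      filter_upwards [ae_restrict_mem (measurableSet_Ioi.prod measurableSet_Ioi)] with p hp
      have h1 : 0 < p.1 := hp.1
      have h2 : 0 < p.2 := hp.2
      simp only [Function.uncurry_def]
      rw [Real.norm_of_nonneg (by positivity)]
      have h3 : p.1 ^ (a - 1) * Real.exp (-(1 * p.1)) * (p.2 ^ (c - 1) * Real.exp (-(1 * p.2))) =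
          p.1 ^ (a - 1) * p.2 ^ (c - 1) * Real.exp (-p.1 - p.2) := by
        rw [show -p.1 - p.2 = -(1 * p.1) + -(1 * p.2) by ring, Real.exp_add]
        ring
      rw [h3]
      refine mul_le_mul_of_nonneg_left (Real.exp_le_exp.2 ?_) (by positivity)
      have : 0 ≤ p.1 * p.2 / x := by positivity
      linarith

/-- Kummer's transformation `U(a, b, z) = z^(1-b) U(a-b+1, 2-b, z)`. -/
theorem Gamma_mul_tricomiIntegral {a c : ℝ} (ha : 0 < a) (hc : 0 < c) {z : ℂ}
    (hz : z ∈ Complex.slitPlane) :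
    (Real.Gamma c : ℂ) * tricomiIntegral a c z = Real.Gamma a * tricomiIntegral c a z := by
  have h1 := ((differentiableOn_tricomiIntegral ha hc.le).const_mul
    (Real.Gamma c : ℂ)).analyticOnNhd Complex.isOpen_slitPlane
  have h2 := ((differentiableOn_tricomiIntegral hc ha.le).const_mul
    (Real.Gamma a : ℂ)).analyticOnNhd Complex.isOpen_slitPlane
  -- Both sides are analytic on the connected slit plane and agree at all reals above 1.
  exact h1.eqOn_of_preconnected_of_frequently_eq h2
    (Complex.starConvex_one_slitPlane.isPathConnected (by simp)).isConnected.isPreconnected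
    (z₀ := ((1 : ℝ) : ℂ)) (by simp) (frequently_nhdsNE_ofReal fun y hy =>
      Gamma_mul_tricomiIntegral_of_pos ha hc (one_pos.trans hy)) hz

/-! ### The squared modulus as a Laplace transform. -/

/-- The integrand of `tricomiIntegral a c (t * x)` after the substitution `s = t * u`. -/
noncomputable def laplaceIntegrand (a c t : ℝ) (x : ℂ) (u : ℝ) : ℂ :=
  ((u ^ (a - 1) * Real.exp (-(t * u)) : ℝ) : ℂ) * (1 + (u : ℂ) / x) ^ (-c : ℂ)

/-- The density whose Laplace transform is the product of those of two integrands
`laplaceIntegrand`. -/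
noncomputable def productDensity (a c : ℝ) (x : ℂ) (r : ℝ) : ℝ :=
  r ^ (a + c - 1) * ∫ s in Ioo (0 : ℝ) 1, s ^ (a - 1) * (1 - s) ^ (c - 1) *
    (1 - s + s * Complex.normSq (1 + r / x)) ^ (-c)

theorem integrableOn_laplaceIntegrand {a c t : ℝ} (ha : 0 < a) (hc : 0 ≤ c) (ht : 0 < t) {x : ℂ}
    (hx : x ∈ Complex.slitPlane) : IntegrableOn (laplaceIntegrand a c t x) (Ioi 0) := by
  obtain ⟨ε, hε, C, -, hC⟩ := exists_norm_one_add_div_cpow_neg_le hx hc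
  refine ((integrableOn_rpow_mul_exp_neg_mul ha ht).mul_const C).mono'
    (Measurable.aestronglyMeasurable (by unfold laplaceIntegrand; fun_prop)) ?_
  filter_upwards [ae_restrict_mem measurableSet_Ioi] with s hs
  have hs : 0 < s := hs
  rw [laplaceIntegrand, norm_mul, Complex.norm_real, Real.norm_of_nonneg (by positivity)]
  gcongr
  exact hC x (Metric.mem_ball_self hε) s hs.le

theorem tricomiIntegral_ofReal_mul {a c t : ℝ} (ht : 0 < t) (x : ℂ) :
    tricomiIntegral a c (t * x) = (t ^ a : ℝ) * ∫ u in Ioi 0, laplaceIntegrand a c t x u := by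
  have h := integral_comp_mul_left_Ioi' (fun s : ℝ => ((s ^ (a - 1) * Real.exp (-s) : ℝ) : ℂ) *
    (1 + (s : ℂ) / (t * x)) ^ (-c : ℂ)) 0 ht
  rw [mul_zero] at h
  rw [tricomiIntegral, ← h, Complex.real_smul, ← integral_const_mul, ← integral_const_mul]
  refine setIntegral_congr_fun measurableSet_Ioi fun u hu => ?_
  have hu : 0 < u := hu
  have ht' : (t : ℂ) ≠ 0 := by exact_mod_cast ht.ne'
  have h1 : ((t * u : ℝ) : ℂ) / (t * x) = u / x := by
    push_cast
    exact mul_div_mul_left _ _ ht'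
  rw [h1, Real.mul_rpow ht.le hu.le, laplaceIntegrand, ← mul_assoc, ← mul_assoc,
    ← Complex.ofReal_mul, ← Complex.ofReal_mul]
  congr 2
  rw [Real.rpow_sub_one ht.ne']
  field_simp

theorem conj_tricomiIntegral {a c : ℝ} {z : ℂ} (hz : z ∈ Complex.slitPlane) :
    starRingEnd ℂ (tricomiIntegral a c z) = tricomiIntegral a c (starRingEnd ℂ z) := by
  rw [tricomiIntegral, ← integral_conj]
  refine setIntegral_congr_fun measurableSet_Ioi fun s hs => ?_
  have hs : 0 < s := hs
  have h := Complex.conj_cpow (1 + s / z) (-c : ℂ)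
    (Complex.slitPlane_arg_ne_pi (one_add_div_mem_slitPlane hz hs.le))
  simp only [map_neg, Complex.conj_ofReal, map_add, map_one, map_div₀] at h
  simp only [map_mul, Complex.conj_ofReal]
  rw [← h]

/-- The base 1-s+sQ is a convex combination of 1 and Q > 0, so it is at least min(1,Q); this gives
both positivity and domination by a Beta integrand. -/
theorem productDensity_pos {a c : ℝ} (ha : 0 < a) (hc : 0 < c) {x : ℂ}
    (hx : x ∈ Complex.slitPlane) {r : ℝ} (hr : 0 < r) : 0 < productDensity a c x r := by
  have hq : 0 < Complex.normSq (1 + r / x) :=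
    Complex.normSq_pos.2 (Complex.slitPlane_ne_zero (one_add_div_mem_slitPlane hx hr.le))
  set Q := Complex.normSq (1 + r / x)
  refine mul_pos (Real.rpow_pos_of_pos hr _) ?_
  have hδ : 0 < min 1 Q := lt_min one_pos hq
  have hle : ∀ s ∈ Ioo (0 : ℝ) 1, min 1 Q ≤ 1 - s + s * Q := fun s hs => by
    have h1 : (1 - s) * min 1 Q ≤ (1 - s) * 1 :=
      mul_le_mul_of_nonneg_left (min_le_left _ _) (by linarith [hs.2])
    have h2 : s * min 1 Q ≤ s * Q := mul_le_mul_of_nonneg_left (min_le_right _ _) hs.1.le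
    linarith
  have hpos : ∀ s ∈ Ioo (0 : ℝ) 1,
      0 < s ^ (a - 1) * (1 - s) ^ (c - 1) * (1 - s + s * Q) ^ (-c) := fun s hs => by
    have h1 := hδ.trans_le (hle s hs)
    have h2 : 0 < 1 - s := by linarith [hs.2]
    have h3 := hs.1
    positivity
  have hint : IntegrableOn (fun s : ℝ => s ^ (a - 1) * (1 - s) ^ (c - 1) *
      (1 - s + s * Q) ^ (-c)) (Ioo 0 1) := by
    refine ((integrableOn_beta ha hc).mul_const (min 1 Q ^ (-c))).mono'
      (Measurable.aestronglyMeasurable (by fun_prop)) ?_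
    filter_upwards [ae_restrict_mem measurableSet_Ioo] with s hs
    have h2 : 0 < 1 - s := by linarith [hs.2]
    have h3 := hs.1
    rw [Real.norm_of_nonneg (hpos s hs).le]
    exact mul_le_mul_of_nonneg_left
      (Real.rpow_le_rpow_of_nonpos hδ (hle s hs) (by linarith)) (by positivity)
  refine (setIntegral_pos_iff_support_of_nonneg_ae ?_ hint).2 ?_
  · filter_upwards [ae_restrict_mem measurableSet_Ioo] with s hs using (hpos s hs).le
  · have hsub : Ioo (0 : ℝ) 1 ⊆ Function.support fun s : ℝ =>
        s ^ (a - 1) * (1 - s) ^ (c - 1) * (1 - s + s * Q) ^ (-c) := fun s hs => (hpos s hs).ne'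
    rw [inter_eq_self_of_subset_right hsub]
    simp

/-- Scaling u = rs turns the convolution into the Euler integral at q = 1 + r/x, since 1 + rs/x =
(1-s) + sq; the exponentials combine to e^(-tr). -/
theorem intervalIntegral_laplaceIntegrand_mul {a c t : ℝ} (ha : 0 < a) (hc : 0 < c) {x : ℂ}
    (hx : x ∈ Complex.slitPlane) {r : ℝ} (hr : 0 < r) :
    ∫ u in (0 : ℝ)..r, laplaceIntegrand a c t x u *
        laplaceIntegrand c a t (starRingEnd ℂ x) (r - u) =
      ((Real.exp (-(t * r)) * productDensity a c x r : ℝ) : ℂ) := by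
  have hq := one_add_div_mem_slitPlane hx hr.le
  have h := intervalIntegral.smul_integral_comp_mul_left (a := 0) (b := 1)
    (fun u : ℝ => laplaceIntegrand a c t x u *
      laplaceIntegrand c a t (starRingEnd ℂ x) (r - u)) r
  rw [mul_zero, mul_one] at h
  rw [← h, intervalIntegral.integral_of_le zero_le_one, integral_Ioc_eq_integral_Ioo,
    productDensity, ← mul_assoc, Complex.ofReal_mul _ (∫ _ in _, _),
    ← integral_segment_cpow_conj ha hc hq, Complex.real_smul, ← integral_const_mul,
    ← integral_const_mul]
  refine setIntegral_congr_fun measurableSet_Ioo fun s hs => ?_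
  have hs0 := hs.1
  have hs1 : 0 < 1 - s := by linarith [hs.2]
  have e1 : (1 : ℂ) + ((r * s : ℝ) : ℂ) / x = (1 - s : ℂ) + s * (1 + r / x) := by
    push_cast
    ring
  have e2 : (1 : ℂ) + ((r - r * s : ℝ) : ℂ) / starRingEnd ℂ x =
      (s : ℂ) + (1 - s) * starRingEnd ℂ (1 + r / x) := by
    rw [map_add, map_one, map_div₀, Complex.conj_ofReal]
    push_cast
    ring
  simp only [laplaceIntegrand]
  rw [e1, e2]
  have e3 : r * ((r * s) ^ (a - 1) * Real.exp (-(t * (r * s))) *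
      ((r - r * s) ^ (c - 1) * Real.exp (-(t * (r - r * s))))) =
      Real.exp (-(t * r)) * r ^ (a + c - 1) * (s ^ (a - 1) * (1 - s) ^ (c - 1)) := by
    rw [show r - r * s = r * (1 - s) by ring, Real.mul_rpow hr.le hs0.le,
      Real.mul_rpow hr.le hs1.le, show -(t * r) = -(t * (r * s)) + -(t * (r * (1 - s))) by ring,
      Real.exp_add, show a + c - 1 = (a - 1) + (c - 1) + 1 by ring, Real.rpow_add_one hr.ne',
      Real.rpow_add hr]
    ring
  have e3' := congrArg (fun y : ℝ => (y : ℂ)) e3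
  simp only [Complex.ofReal_mul] at e3' ⊢
  linear_combination (((1 - s : ℂ) + s * (1 + r / x)) ^ (-c : ℂ) *
    ((s : ℂ) + (1 - s) * starRingEnd ℂ (1 + r / x)) ^ (-a : ℂ)) * e3'

theorem conj_mem_slitPlane {z : ℂ} (hz : z ∈ Complex.slitPlane) :
    starRingEnd ℂ z ∈ Complex.slitPlane := by
  simpa [Complex.mem_slitPlane_iff] using hz

theorem integrableOn_exp_mul_productDensity {a c t : ℝ} (ha : 0 < a) (hc : 0 < c) (ht : 0 < t)
    {x : ℂ} (hx : x ∈ Complex.slitPlane) :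
    IntegrableOn (fun r => Real.exp (-(t * r)) * productDensity a c x r) (Ioi 0) := by
  have h := (integrable_posConvolution (integrableOn_laplaceIntegrand ha hc.le ht hx)
    (integrableOn_laplaceIntegrand hc ha.le ht (conj_mem_slitPlane hx))
    (ContinuousLinearMap.mul ℝ ℂ)).integrableOn (s := Ioi (0 : ℝ))
  refine (integrableOn_congr_fun (fun r hr => ?_) measurableSet_Ioi).1 h.re
  simp only [posConvolution, indicator_of_mem hr, ContinuousLinearMap.mul_apply']
  rw [intervalIntegral_laplaceIntegrand_mul ha hc hx hr]
  simp only [RCLike.re_to_complex, Complex.ofReal_re]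

theorem integral_laplaceIntegrand_mul_integral {a c t : ℝ} (ha : 0 < a) (hc : 0 < c) (ht : 0 < t)
    {x : ℂ} (hx : x ∈ Complex.slitPlane) :
    (∫ u in Ioi 0, laplaceIntegrand a c t x u) *
      (∫ u in Ioi 0, laplaceIntegrand c a t (starRingEnd ℂ x) u) =
      ((∫ r in Ioi 0, Real.exp (-(t * r)) * productDensity a c x r : ℝ) : ℂ) := by
  have h := integral_posConvolution (integrableOn_laplaceIntegrand ha hc.le ht hx)
    (integrableOn_laplaceIntegrand hc ha.le ht (conj_mem_slitPlane hx))
    (ContinuousLinearMap.mul ℝ ℂ)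
  simp only [ContinuousLinearMap.mul_apply'] at h
  rw [← h, ← integral_complex_ofReal]
  exact setIntegral_congr_fun measurableSet_Ioi fun r hr =>
    intervalIntegral_laplaceIntegrand_mul ha hc hx hr

theorem ofReal_mul_mem_slitPlane {t : ℝ} (ht : 0 < t) {x : ℂ} (hx : x ∈ Complex.slitPlane) :
    (t : ℂ) * x ∈ Complex.slitPlane := by
  rw [Complex.mem_slitPlane_iff] at hx ⊢
  simpa [ht, ht.ne'] using hx

theorem norm_tricomiIntegral_sq {a c t : ℝ} (ha : 0 < a) (hc : 0 < c) (ht : 0 < t)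
    {x : ℂ} (hx : x ∈ Complex.slitPlane) :
    ‖tricomiIntegral a c (t * x)‖ ^ 2 = Real.Gamma a / Real.Gamma c * t ^ (a + c) *
      ∫ r in Ioi 0, Real.exp (-(t * r)) * productDensity a c x r := by
  have hz := ofReal_mul_mem_slitPlane ht hx
  have hG : (Real.Gamma c : ℂ) ≠ 0 := by exact_mod_cast (Real.Gamma_pos_of_pos hc).ne'
  have h1 := Gamma_mul_tricomiIntegral ha hc (conj_mem_slitPlane hz)
  rw [map_mul, Complex.conj_ofReal] at h1
  have h2 := integral_laplaceIntegrand_mul_integral ha hc ht hx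
  have h3 := tricomiIntegral_ofReal_mul (a := a) (c := c) ht x
  have h4 := tricomiIntegral_ofReal_mul (a := c) (c := a) ht (starRingEnd ℂ x)
  have h5 : ((‖tricomiIntegral a c (t * x)‖ ^ 2 : ℝ) : ℂ) =
      tricomiIntegral a c (t * x) * tricomiIntegral a c (t * starRingEnd ℂ x) := by
    rw [Complex.ofReal_pow, ← Complex.mul_conj', conj_tricomiIntegral hz, map_mul,
      Complex.conj_ofReal]
  apply Complex.ofReal_injective
  rw [h5]
  simp only [Complex.ofReal_mul, Complex.ofReal_div, Real.rpow_add ht, ← h2]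
  rw [h4] at h1
  rw [h3]
  field_simp
  linear_combination ((t ^ a : ℝ) : ℂ) * (∫ u in Ioi 0, laplaceIntegrand a c t x u) * h1

/-! ### The Whittaker function: generic and degenerate parameters. -/

theorem norm_exp_mul_cpow_sq (p : ℝ) (z : ℂ) :
    ‖Complex.exp (-z / 2) * z ^ (p : ℂ)‖ ^ 2 = Real.exp (-z.re) * (‖z‖ ^ p) ^ 2 := by
  rw [norm_mul, mul_pow, Complex.norm_cpow_real, Complex.norm_exp, ← Real.exp_nat_mul]
  congr 2
  simp
  ring

theorem norm_whittakerW_sq_of_pos {k m : ℝ} (ha : 0 < 1 / 2 + m - k) {z : ℂ} (hz : z ≠ 0) :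
    ‖whittakerW k m z‖ ^ 2 = Real.exp (-z.re) * ‖z‖ ^ (2 * k) *
      (‖tricomiIntegral (1 / 2 + m - k) (1 / 2 - m - k) z‖ ^ 2 /
        Real.Gamma (1 / 2 + m - k) ^ 2) := by
  have e1 : (1 / 2 + m - k : ℂ) = ((1 / 2 + m - k : ℝ) : ℂ) := by push_cast; rfl
  have e2 : (1 / 2 + m : ℂ) = ((1 / 2 + m : ℝ) : ℂ) := by push_cast; rfl
  have e3 : (1 + 2 * m - ((1 / 2 + m - k : ℝ) : ℂ) - 1 : ℂ) = -((1 / 2 - m - k : ℝ) : ℂ) := by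
    push_cast; ring
  have hU : tricomiU (1 / 2 + m - k) (1 + 2 * m) z =
      z ^ ((-(1 / 2 + m - k) : ℝ) : ℂ) / (Real.Gamma (1 / 2 + m - k) : ℂ) *
        tricomiIntegral (1 / 2 + m - k) (1 / 2 - m - k) z := by
    rw [e1, tricomiU_of_re_pos _ _ _ (by simpa using ha), e3, tricomiIntegral,
      Complex.Gamma_ofReal, Complex.ofReal_neg]
    congr 1
    refine setIntegral_congr_fun measurableSet_Ioi fun s hs => ?_
    have hs : 0 ≤ s := le_of_lt hs
    rw [Complex.ofReal_mul (s ^ _), Complex.ofReal_cpow hs, Complex.ofReal_exp]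
    push_cast
    ring
  have hz' := norm_pos_iff.2 hz
  have e4 : ‖z‖ ^ (2 * k) = (‖z‖ ^ (1 / 2 + m)) ^ 2 * (‖z‖ ^ (-(1 / 2 + m - k))) ^ 2 := by
    rw [← mul_pow, ← Real.rpow_add hz', ← Real.rpow_mul_natCast hz'.le]
    congr 1
    push_cast
    ring
  rw [whittakerW, hU, e2, norm_mul, mul_pow, norm_exp_mul_cpow_sq, norm_mul, norm_div,
    Complex.norm_cpow_real, Complex.norm_real, Real.norm_of_nonneg (Real.Gamma_pos_of_pos ha).le, e4]
  ring

theorem tricomiIntegral_zero_right {a : ℝ} (ha : 0 < a) (z : ℂ) :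
    tricomiIntegral a 0 z = Real.Gamma a := by
  have h := Real.integral_rpow_mul_exp_neg_mul_Ioi ha one_pos
  simp only [one_mul, div_one, Real.one_rpow] at h
  simp only [tricomiIntegral, Complex.ofReal_zero, neg_zero, Complex.cpow_zero, mul_one]
  rw [integral_complex_ofReal, h]

/-- At a = 0 the definition takes n = 1: the weight s^(a+n-1) is 1 and Γ(1) = 1, so minus the
integral of φ' remains, which is φ(0) = 1. -/
theorem tricomiU_zero_left {b : ℂ} {c : ℝ} (hc : 0 ≤ c) (hb : b - 1 = -c) {z : ℂ}
    (hz : z ∈ Complex.slitPlane) : tricomiU 0 b z = 1 := by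
  have hn : ⌊1 - (0 : ℂ).re⌋₊ = 1 := by simp
  have hz0 := Complex.slitPlane_ne_zero hz
  set φ : ℝ → ℂ := fun r => Complex.exp (-(r : ℂ)) * (1 + (r : ℂ) / z) ^ (-c : ℂ) with hφ
  set φ' : ℝ → ℂ := fun r => -Complex.exp (-(r : ℂ)) * (1 + (r : ℂ) / z) ^ (-c : ℂ) +
    Complex.exp (-(r : ℂ)) * (-c * (1 + (r : ℂ) / z) ^ (-((c + 1 : ℝ) : ℂ)) * (1 / z)) with hφ'
  have hder : ∀ r ∈ Ici (0 : ℝ), HasDerivAt φ (φ' r) r := by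
    intro r hr
    have hof := Complex.ofRealCLM.hasDerivAt (x := r)
    have h1 : HasDerivAt (fun r : ℝ => Complex.exp (-(r : ℂ))) (-Complex.exp (-(r : ℂ))) r := by
      simpa using hof.neg.cexp
    have h2 : HasDerivAt (fun r : ℝ => 1 + (r : ℂ) / z) (1 / z) r := by
      simpa using (hof.div_const z).const_add 1
    have h3 : HasDerivAt (fun w : ℂ => w ^ (-c : ℂ)) _ (1 + (r : ℂ) / z) :=
      (hasDerivAt_id _).cpow_const (one_add_div_mem_slitPlane hz hr)
    have h4 := h1.mul (h3.comp r h2)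
    convert! h4 using 1
    simp only [hφ', Function.comp, id, mul_one]
    rw [show (-((c + 1 : ℝ) : ℂ)) = -c - 1 by push_cast; ring]
  obtain ⟨ε, hε, C₁, -, hC₁⟩ := exists_norm_one_add_div_cpow_neg_le hz hc
  obtain ⟨ε', hε', C₂, -, hC₂⟩ := exists_norm_one_add_div_cpow_neg_le hz (c := c + 1) (by linarith)
  replace hC₁ := hC₁ z (Metric.mem_ball_self hε)
  replace hC₂ := hC₂ z (Metric.mem_ball_self hε')
  have hnorm : ∀ r : ℝ, ‖Complex.exp (-(r : ℂ))‖ = Real.exp (-r) := fun r => by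
    rw [← Complex.ofReal_neg, Complex.norm_exp_ofReal]
  have hint : IntegrableOn φ' (Ioi 0) := by
    refine ((integrableOn_exp_neg_Ioi 0).mul_const (C₁ + c * C₂ * ‖1 / z‖)).mono'
      (Measurable.aestronglyMeasurable (by fun_prop)) ?_
    filter_upwards [ae_restrict_mem measurableSet_Ioi] with r hr
    have hr : 0 ≤ r := le_of_lt hr
    refine (norm_add_le _ _).trans ?_
    rw [mul_add, norm_mul, norm_neg, hnorm, norm_mul, hnorm, norm_mul, norm_mul, norm_neg,
      Complex.norm_real, Real.norm_of_nonneg hc]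
    gcongr
    · exact hC₁ r hr
    · exact hC₂ r hr
  have hlim : Filter.Tendsto φ Filter.atTop (nhds 0) := by
    refine squeeze_zero_norm' (a := fun r => Real.exp (-r) * C₁) ?_ ?_
    · filter_upwards [Filter.eventually_ge_atTop 0] with r hr
      rw [hφ, norm_mul, hnorm]
      gcongr
      exact hC₁ r hr
    · simpa using Real.tendsto_exp_neg_atTop_nhds_zero.mul_const C₁
  have h := integral_Ioi_of_hasDerivAt_of_tendsto' hder hint hlim
  have hφ0 : φ 0 = 1 := by simp [hφ]
  simp only [tricomiU, hn, sub_zero, hb, iteratedDeriv_one]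
  have hcongr : ∫ s in Ioi (0 : ℝ), (s : ℂ) ^ (0 + ((1 : ℕ) : ℂ) - 1) * deriv φ s =
      ∫ s in Ioi (0 : ℝ), φ' s :=
    setIntegral_congr_fun measurableSet_Ioi fun s hs => by
      simp [(hder s (Ioi_subset_Ici_self hs)).deriv]
  rw [hcongr, h, hφ0]
  simp

theorem norm_whittakerW_sq_of_eq_zero {k m : ℝ} (hk : k < 1 / 2)
    (h : 1 / 2 + m - k = 0 ∨ 1 / 2 - m - k = 0) {z : ℂ} (hz : z ∈ Complex.slitPlane) :
    ‖whittakerW k m z‖ ^ 2 = Real.exp (-z.re) * ‖z‖ ^ (2 * k) := by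
  rcases h with h | h
  · have hm : m = k - 1 / 2 := by linarith
    subst hm
    have e1 : (1 / 2 + ((k - 1 / 2 : ℝ) : ℂ) - k) = 0 := by push_cast; ring
    have e2 : (1 / 2 + ((k - 1 / 2 : ℝ) : ℂ)) = (k : ℂ) := by push_cast; ring
    rw [whittakerW, e1, e2, tricomiU_zero_left (c := 1 - 2 * k) (by linarith)
      (by push_cast; ring) hz, mul_one, norm_exp_mul_cpow_sq, ← Real.rpow_mul_natCast (norm_nonneg z)]
    congr 2
    push_cast
    ring
  · have ha : 0 < 1 / 2 + m - k := by linarith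
    rw [norm_whittakerW_sq_of_pos ha (Complex.slitPlane_ne_zero hz), h,
      tricomiIntegral_zero_right ha, Complex.norm_real,
      Real.norm_of_nonneg (Real.Gamma_pos_of_pos ha).le, div_self, mul_one]
    exact pow_ne_zero 2 (Real.Gamma_pos_of_pos ha).ne'

theorem theorem3p3 (k m : ℝ) (hk : k < 1 / 2) (hm₁ : k - 1 / 2 ≤ m) (hm₂ : m ≤ 1 / 2 - k)
    (x : ℂ) (hx : x ≠ 0) (harg : |x.arg| < Real.pi) :
    StrictlyCompletelyMonotone (fun t : ℝ =>
      t⁻¹ * Real.exp (t * x.re) * ‖whittakerW (k : ℂ) (m : ℂ) ((t : ℂ) * x)‖ ^ 2) := by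
  have hxs : x ∈ Complex.slitPlane :=
    Complex.mem_slitPlane_iff_arg.2 ⟨(lt_of_abs_lt harg).ne, hx⟩
  have hx' : 0 < ‖x‖ ^ (2 * k) := Real.rpow_pos_of_pos (norm_pos_iff.2 hx) _
  have hfactor : ∀ t : ℝ, 0 < t → t⁻¹ * Real.exp (t * x.re) *
      (Real.exp (-((t : ℂ) * x).re) * ‖(t : ℂ) * x‖ ^ (2 * k)) =
      ‖x‖ ^ (2 * k) * t ^ (2 * k - 1) := fun t ht => by
    rw [norm_mul, Complex.norm_real, Real.norm_of_nonneg ht.le,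
      Real.mul_rpow ht.le (norm_nonneg x), Complex.re_ofReal_mul, Real.exp_neg,
      Real.rpow_sub_one ht.ne']
    field_simp
  by_cases h : 1 / 2 + m - k = 0 ∨ 1 / 2 - m - k = 0
  -- Here f(t) = |x|^(2k) t^(2k-1), and t^(-β) is the transform of r^(β-1)/Γ(β) with β = 1 - 2k.
  · have hβ : 0 < 1 - 2 * k := by linarith
    have hG := Real.Gamma_pos_of_pos hβ
    have hmul : ∀ t r : ℝ, Real.exp (-(t * r)) *
        (‖x‖ ^ (2 * k) / Real.Gamma (1 - 2 * k) * r ^ (1 - 2 * k - 1)) =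
        ‖x‖ ^ (2 * k) / Real.Gamma (1 - 2 * k) *
          (r ^ (1 - 2 * k - 1) * Real.exp (-(t * r))) := fun t r => by ring
    refine strictlyCompletelyMonotone_of_laplace (h := fun r =>
      ‖x‖ ^ (2 * k) / Real.Gamma (1 - 2 * k) * r ^ (1 - 2 * k - 1)) (fun r hr => by positivity)
      (fun t ht => ?_) fun t ht => ?_
    · simp only [hmul]
      exact (integrableOn_rpow_mul_exp_neg_mul hβ ht).const_mul _
    · simp only [hmul]
      rw [norm_whittakerW_sq_of_eq_zero hk h (ofReal_mul_mem_slitPlane ht hxs), hfactor t ht,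
        integral_const_mul, Real.integral_rpow_mul_exp_neg_mul_Ioi hβ ht, one_div,
        Real.inv_rpow ht.le, ← Real.rpow_neg ht.le, neg_sub]
      field_simp
  · push Not at h
    have ha : 0 < 1 / 2 + m - k := lt_of_le_of_ne (by linarith) h.1.symm
    have hc : 0 < 1 / 2 - m - k := lt_of_le_of_ne (by linarith) h.2.symm
    -- The prefactor t^(2k-1) exactly cancels the t^(a+c) of `norm_tricomiIntegral_sq`.
    have hab : (2 * k - 1) + (1 / 2 + m - k + (1 / 2 - m - k)) = 0 := by ring
    have hW : ∀ z : ℂ, z ≠ 0 → _ := fun z hz => norm_whittakerW_sq_of_pos ha hz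
    set a := 1 / 2 + m - k
    set c := 1 / 2 - m - k
    have hGa := Real.Gamma_pos_of_pos ha
    have hGc := Real.Gamma_pos_of_pos hc
    have hmul : ∀ t r : ℝ, Real.exp (-(t * r)) *
        (‖x‖ ^ (2 * k) / (Real.Gamma a * Real.Gamma c) * productDensity a c x r) =
        ‖x‖ ^ (2 * k) / (Real.Gamma a * Real.Gamma c) *
          (Real.exp (-(t * r)) * productDensity a c x r) := fun t r => by ring
    refine strictlyCompletelyMonotone_of_laplace (h := fun r =>
      ‖x‖ ^ (2 * k) / (Real.Gamma a * Real.Gamma c) * productDensity a c x r) (fun r hr => ?_)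
      (fun t ht => ?_) fun t ht => ?_
    · have := productDensity_pos ha hc hxs hr
      positivity
    · simp only [hmul]
      exact (integrableOn_exp_mul_productDensity ha hc ht hxs).const_mul _
    · have hz := ofReal_mul_mem_slitPlane ht hxs
      have hpow : t ^ (2 * k - 1) * t ^ (a + c) = 1 := by
        rw [← Real.rpow_add ht, hab, Real.rpow_zero]
      simp only [hmul]
      rw [hW _ (Complex.slitPlane_ne_zero hz), ← mul_assoc, hfactor t ht,
        norm_tricomiIntegral_sq ha hc ht hxs, integral_const_mul]
      field_simp
      linear_combination (∫ r in Ioi 0, Real.exp (-(t * r)) * productDensity a c x r) * hpow
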